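/- A measurable, non-constant function $g:\mathbb R\to\mathbb R$ is called totally positive (TP) if $\det\bigl(g(x_j-y_k)\bigr)_{j,k=1}^N\ge 0$ for all $N\in\mathbb N$ and all real $x_1<\dots<x_N$, $y_1<\dots<y_N$. Let $(a_\nu)_{\nu\ge 1}$ be a sequence of non-zero real numbers with $\sum_{\nu=1}^\infty a_\nu^{-2}<\infty$, and let $a_0:=\min_{\nu\ge 1}|a_\nu|$. Let $g$ (the TP function of infinite type) and $g_n$, $n\ge 1$ (the TP functions of type $n$) be integrable functions $\mathbb R\to\mathbb R$ whose Fourier transforms $\hat f(\omega)=\int_{\mathbb R}f(t)e^{-2\pi i t\omega}\,dt$ are $$\hat g(\omega)=\prod_{\nu=1}^{\infty}\frac{e^{2\pi i\omega/a_\nu}}{1+2\pi i\omega/a_\nu},\qquad \hat g_n(\omega)=\prod_{\nu=1}^{n}\frac{e^{2\pi i\omega/a_\nu}}{1+2\pi i\omega/a_\nu}\qquad(\omega\in\mathbb R).$$ Since this determines the functions only up to null sets, assume moreover that each of them is TP or, alternatively, continuous. Then for every $0\le\sigma<a_0$ $$\lim_{n\to\infty}|g(x)-g_n(x)|\,e^{\sigma|x|}=0\quad\text{uniformly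 for }x\in\mathbb R.$$ The same holds for all derivatives: $g\in C^\infty(\mathbb R)$, and for every integer $r\ge 0$ we have $g_n\in C^r(\mathbb R)$ for all sufficiently large $n$, and for every $0\le\sigma<a_0$ $$\lim_{n\to\infty}|g^{(r)}(x)-g_n^{(r)}(x)|\,e^{\sigma|x|}=0\quad\text{uniformly for }x\in\mathbb R.$$ -/

import Mathlib

open scoped FourierTransform ContDiff

/-- Totally positive functions: measurable, non-constant functions `g : ℝ → ℝ` all of whose
matrices `(g (x j - y k))` with increasing nodes `x`, `y` have a non-negative determinant. -/
structure IsTotallyPositive (g : ℝ → ℝ) : Prop where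
  measurable : Measurable g
  nonconstant : ¬ ∃ c : ℝ, ∀ x, g x = c
  det_nonneg : ∀ (N : ℕ) (x y : Fin N → ℝ), StrictMono x → StrictMono y →
    0 ≤ (Matrix.of fun j k : Fin N => g (x j - y k)).det

/-- The factor `exp (2πiw/a) / (1 + 2πiw/a)`. -/
noncomputable def tpFactor (a w : ℝ) : ℂ :=
  Complex.exp (2 * Real.pi * Complex.I * (w / a)) / (1 + 2 * Real.pi * Complex.I * (w / a))

/-- `g` is the totally positive function of type `n` with weights `a 0, …, a (n - 1)`: it is
integrable and its Fourier transform `∫ g(t) exp (-2πitw) dt` is the product of the `n` factors.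
The transform determines `g` only almost everywhere; the pointwise values are fixed by requiring
that `g` is totally positive or, alternatively, that `g` is the continuous representative. -/
structure IsTPOfFiniteType (a : ℕ → ℝ) (n : ℕ) (g : ℝ → ℝ) : Prop where
  integrable : MeasureTheory.Integrable g
  fourier : ∀ w : ℝ, 𝓕 (fun t : ℝ => (g t : ℂ)) w = ∏ ν ∈ Finset.range n, tpFactor (a ν) w
  representative : IsTotallyPositive g ∨ Continuous g

/-- `g` is the totally positive function of infinite type with weights `a 0, a 1, …`: as for the
finite type, with the infinite product as Fourier transform. -/
structure IsTPOfInfiniteType (a : ℕ → ℝ) (g : ℝ → ℝ) : Prop where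
  integrable : MeasureTheory.Integrable g
  fourier : ∀ w : ℝ, HasProd (fun ν : ℕ => tpFactor (a ν) w) (𝓕 (fun t : ℝ => (g t : ℂ)) w)
  representative : IsTotallyPositive g ∨ Continuous g

open scoped FourierTransform ContDiff Convolution SchwartzMap
open MeasureTheory Filter Topology

/-! For `|s| < a₀`, multiplying by `exp (s x)` moves the Fourier transform to a parallel line in the
complex plane that meets no pole, turning each factor into `tiltedFactor`
(`fourierInv_tiltedProd_eq`, `fourierInv_tiltedLim_eq`). Weighted uniform convergence of derivatives
then follows from `L¹` convergence of the shifted products against powers of `|w|`. This is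
dominated convergence (`tendsto_integral_tiltedProd_sub`): the factors are `1 + O(a_ν⁻²)`, so the
products converge pointwise, and `M` factors already give decay of order `M`, which the remaining
ones preserve uniformly (`exists_tiltedProd_uniform_decay`). Taking `s = ±σ` covers the weight `exp
(σ|x|)`.

Pointwise values are settled separately: the 2×2 minors force a totally positive function to equal
its continuous representative (`IsTotallyPositive.eq_of_ae_eq_continuous`). -/

/-! ### Total positivity and pointwise values. -/

theorem IsTotallyPositive.nonneg {g : ℝ → ℝ} (hg : IsTotallyPositive g) (x : ℝ) : 0 ≤ g x := by
  have := hg.det_nonneg 1 (fun _ => x) (fun _ => 0) (Subsingleton.strictMono _)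
    (Subsingleton.strictMono _)
  simpa using this

/-- The two-by-two minors of a totally positive function. -/
theorem IsTotallyPositive.mul_le_mul {g : ℝ → ℝ} (hg : IsTotallyPositive g) (u : ℝ) {s t : ℝ}
    (hs : 0 < s) (ht : 0 < t) : g u * g (u + s + t) ≤ g (u + t) * g (u + s) := by
  have := hg.det_nonneg 2 ![u, u + s] ![-t, 0] (by
      intro i j hij; fin_cases i <;> fin_cases j <;> simp_all) (by
      intro i j hij; fin_cases i <;> fin_cases j <;> simp_all)
  rw [Matrix.det_fin_two] at this
  simp at this
  linarith

/-- A closed inequality which holds almost everywhere on the open quadrant holds on the closed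
quadrant. -/
theorem le_of_ae_le_of_pos {F G : ℝ × ℝ → ℝ} (hF : Continuous F) (hG : Continuous G)
    (h : ∀ᵐ p : ℝ × ℝ, 0 < p.1 → 0 < p.2 → F p ≤ G p) {s t : ℝ} (hs : 0 ≤ s) (ht : 0 ≤ t) :
    F (s, t) ≤ G (s, t) := by
  have hcl : IsClosed {p | F p ≤ G p} := isClosed_le hF hG
  have hD : Dense {p : ℝ × ℝ | 0 < p.1 → 0 < p.2 → F p ≤ G p} := Measure.dense_of_ae h
  have hU : IsOpen (Set.Ioi (0 : ℝ) ×ˢ Set.Ioi (0 : ℝ)) := isOpen_Ioi.prod isOpen_Ioi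
  have h1 : Set.Ioi (0 : ℝ) ×ˢ Set.Ioi (0 : ℝ) ⊆ {p | F p ≤ G p} := by
    refine (hD.open_subset_closure_inter hU).trans (closure_minimal ?_ hcl)
    rintro p ⟨⟨h1, h2⟩, h3⟩
    exact h3 h1 h2
  have h2 := closure_minimal h1 hcl
  simp only [closure_prod_eq, closure_Ioi] at h2
  exact h2 (Set.mk_mem_prod hs ht)

theorem ae_comp_const_add_mul {p : ℝ → Prop} (h : ∀ᵐ x, p x) (c : ℝ) {β : ℝ} (hβ : β ≠ 0) :
    ∀ᵐ y : ℝ, p (c + β * y) := by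
  have h2 : Measure.QuasiMeasurePreserving (fun y : ℝ => β * y) volume volume := by
    refine ⟨measurable_const_mul β, ?_⟩
    rw [Real.map_volume_mul_left hβ]
    exact Measure.smul_absolutelyContinuous
  exact h2.ae ((measurePreserving_add_left volume c).quasiMeasurePreserving.ae h)

theorem ae_prod_comp_fst {p : ℝ → Prop} (h : ∀ᵐ x, p x) (c : ℝ) {β : ℝ} (hβ : β ≠ 0) :
    ∀ᵐ q : ℝ × ℝ, p (c + β * q.1) :=
  (Measure.quasiMeasurePreserving_fst (μ := (volume : Measure ℝ)) (ν := (volume : Measure ℝ))).ae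
    (ae_comp_const_add_mul h c hβ)

/-- By Fubini: as `β ≠ 0`, every slice in the second variable of the preimage of a null set is null.
-/
theorem ae_prod_comp_add {p : ℝ → Prop} (h : ∀ᵐ x, p x) (c α : ℝ) {β : ℝ} (hβ : β ≠ 0) :
    ∀ᵐ q : ℝ × ℝ, p (c + α * q.1 + β * q.2) := by
  obtain ⟨t, htp, htm, ht0⟩ := exists_measurable_superset_of_null (ae_iff.1 h)
  have hmeas : MeasurableSet ((fun q : ℝ × ℝ => c + α * q.1 + β * q.2) ⁻¹' t) :=
    (by fun_prop : Measurable fun q : ℝ × ℝ => c + α * q.1 + β * q.2) htm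
  have hnull : volume ((fun q : ℝ × ℝ => c + α * q.1 + β * q.2) ⁻¹' t) = 0 := by
    rw [Measure.volume_eq_prod, Measure.measure_prod_null hmeas]
    refine Eventually.of_forall fun x => measure_eq_zero_iff_ae_notMem.2 ?_
    exact ae_comp_const_add_mul (measure_eq_zero_iff_ae_notMem.1 ht0) (c + α * x) hβ
  filter_upwards [measure_eq_zero_iff_ae_notMem.1 hnull] with q hq
  by_contra hp
  exact hq (htp hp)

/-- A totally positive function which agrees almost everywhere with a continuous function that is
not identically zero agrees with it everywhere. -/
theorem IsTotallyPositive.eq_of_ae_eq_continuous {g G : ℝ → ℝ} (hg : IsTotallyPositive g)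
    (hG : Continuous G) (hae : g =ᵐ[volume] G) (hne : ∃ y, G y ≠ 0) : g = G := by
  have hG0 : ∀ x, 0 ≤ G x := by
    intro x
    have hcl : IsClosed {x | 0 ≤ G x} := isClosed_le continuous_const hG
    have hD : Dense {x | 0 ≤ G x} := Measure.dense_of_ae (by
      filter_upwards [hae] with x hx
      exact hx ▸ hg.nonneg x)
    have := hD.closure_eq
    rw [hcl.closure_eq] at this
    exact this.ge (Set.mem_univ x)
  funext x
  -- In the minor inequality only the node `x` keeps its value `g x`; the other nodes are generic,
  -- so `g` becomes `G` there, and they may then tend to limits. Here `x` is the leftmost node, in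
  -- `hL` the rightmost, in `hM` an inner one.
  have hR : ∀ t, 0 ≤ t → g x * G (x + t) ≤ G x * G (x + t) := by
    intro t ht
    have := le_of_ae_le_of_pos (F := fun p => g x * G (x + p.1 + p.2))
      (G := fun p => G (x + p.2) * G (x + p.1)) (by fun_prop) (by fun_prop) (by
        filter_upwards [ae_prod_comp_add hae x 1 one_ne_zero,
          ae_prod_comp_add hae x 0 one_ne_zero,
          ae_prod_comp_fst hae x one_ne_zero]
          with p h1 h2 h3 hs ht
        have := hg.mul_le_mul x hs ht
        simp only [one_mul, zero_mul, add_zero] at h1 h2 h3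
        rwa [h1, h2, h3] at this) (le_refl 0) ht
    simpa [mul_comm] using this
  have hL : ∀ t, 0 ≤ t → g x * G (x - t) ≤ G x * G (x - t) := by
    intro t ht
    have := le_of_ae_le_of_pos (F := fun p => g x * G (x - p.1 - p.2))
      (G := fun p => G (x - p.2) * G (x - p.1)) (by fun_prop) (by fun_prop) (by
        filter_upwards [ae_prod_comp_add hae x (-1) (β := -1) (by norm_num),
          ae_prod_comp_add hae x 0 (β := -1) (by norm_num),
          ae_prod_comp_fst hae x (β := -1) (by norm_num)]
          with p h1 h2 h3 hs ht
        have := hg.mul_le_mul (x - p.1 - p.2) hs ht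
        simp only [neg_mul, one_mul, zero_mul, add_zero, ← sub_eq_add_neg] at h1 h2 h3
        rw [show x - p.1 - p.2 + p.1 + p.2 = x by ring, show x - p.1 - p.2 + p.2 = x - p.1 by ring,
          show x - p.1 - p.2 + p.1 = x - p.2 by ring, h1, h2, h3] at this
        linarith) (le_refl 0) ht
    simpa [mul_comm] using this
  have hM : G x * G x ≤ g x * G x := by
    have := le_of_ae_le_of_pos (F := fun p => G (x - p.1) * G (x + p.2))
      (G := fun p => g x * G (x - p.1 + p.2)) (by fun_prop) (by fun_prop) (by
        filter_upwards [ae_prod_comp_add hae x (-1) one_ne_zero,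
          ae_prod_comp_add hae x 0 one_ne_zero,
          ae_prod_comp_fst hae x (β := -1) (by norm_num)]
          with p h1 h2 h3 hs ht
        have := hg.mul_le_mul (x - p.1) hs ht
        simp only [neg_mul, one_mul, zero_mul, add_zero, ← sub_eq_add_neg] at h1 h2 h3
        rw [show x - p.1 + p.1 = x by ring, h1, h2, h3] at this
        linarith) (le_refl 0) (le_refl 0)
    simpa using this
  obtain ⟨y, hy⟩ := hne
  have hy' : 0 < G y := lt_of_le_of_ne (hG0 y) (Ne.symm hy)
  refine le_antisymm ?_ ?_
  · rcases le_total x y with h | h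
    · have := hR (y - x) (by linarith)
      rw [add_sub_cancel] at this
      exact le_of_mul_le_mul_right this hy'
    · have := hL (x - y) (by linarith)
      rw [sub_sub_cancel] at this
      exact le_of_mul_le_mul_right this hy'
  · rcases (hG0 x).eq_or_lt with h | h
    · rw [← h]; exact hg.nonneg x
    · exact le_of_mul_le_mul_right hM h

/-! ### Fourier inversion and derivatives of inverse transforms. -/

theorem integral_fourier_mul_eq {f g : ℝ → ℂ} (hf : Integrable f) (hg : Integrable g) :
    ∫ x, 𝓕 f x * g x = ∫ x, f x * 𝓕 g x := by
  simpa using! VectorFourier.integral_fourierIntegral_smul_eq_flip (L := innerₗ ℝ)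
    Real.continuous_fourierChar continuous_inner hf hg

theorem continuous_fourier_of_integrable {f : ℝ → ℂ} (hf : Integrable f) : Continuous (𝓕 f) :=
  VectorFourier.fourierIntegral_continuous Real.continuous_fourierChar
    (innerSL ℝ).continuous₂ hf

theorem continuous_fourierInv_of_integrable {f : ℝ → ℂ} (hf : Integrable f) :
    Continuous (𝓕⁻ f) := by
  rw [Real.fourierInv_eq_fourier_comp_neg]
  exact continuous_fourier_of_integrable hf.comp_neg

/-- Fourier inversion almost everywhere. -/
theorem MeasureTheory.Integrable.ae_eq_fourierInv_fourier {f : ℝ → ℂ} (hf : Integrable f)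
    (hF : Integrable (𝓕 f)) : f =ᵐ[volume] 𝓕⁻ (𝓕 f) := by
  refine ae_eq_of_integral_contDiff_smul_eq hf.locallyIntegrable
    (continuous_fourierInv_of_integrable hF).locallyIntegrable fun ψ hψ hc => ?_
  have hc' : HasCompactSupport (fun x => (ψ x : ℂ)) := hc.comp_left Complex.ofReal_zero
  have hψ' : ContDiff ℝ ∞ (fun x => (ψ x : ℂ)) := Complex.ofRealCLM.contDiff.comp hψ
  let φ : 𝓢(ℝ, ℂ) := hc'.toSchwartzMap hψ'
  have hφ : ∀ x, φ x = (ψ x : ℂ) := fun x => rfl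
  -- Writing the test function as a transform lets `𝓕` be moved across the integral twice.
  have hχ : 𝓕 ((𝓕⁻ φ : 𝓢(ℝ, ℂ)) : ℝ → ℂ) = φ := by
    rw [← SchwartzMap.fourier_coe, FourierTransform.fourier_fourierInv_eq]
  have hinv : 𝓕 (fun x => φ (-x)) = ((𝓕⁻ φ : 𝓢(ℝ, ℂ)) : ℝ → ℂ) := by
    rw [SchwartzMap.fourierInv_coe, Real.fourierInv_eq_fourier_comp_neg]
  calc ∫ x, ψ x • f x = ∫ x, f x * 𝓕 ((𝓕⁻ φ : 𝓢(ℝ, ℂ)) : ℝ → ℂ) x := by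
        rw [hχ]; simp_rw [hφ, Complex.real_smul, mul_comm]
    _ = ∫ x, 𝓕 f x * (𝓕⁻ φ : 𝓢(ℝ, ℂ)) x :=
        (integral_fourier_mul_eq hf (SchwartzMap.integrable _)).symm
    _ = ∫ x, 𝓕 (𝓕 f) x * φ (-x) := by
        rw [← hinv, integral_fourier_mul_eq hF (SchwartzMap.integrable φ).comp_neg]
    _ = ∫ x, 𝓕 (𝓕 f) (-x) * φ x := by
        rw [← integral_neg_eq_self]; simp only [neg_neg]
    _ = ∫ x, ψ x • 𝓕⁻ (𝓕 f) x := by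
        simp_rw [Real.fourierInv_eq_fourier_neg, hφ, Complex.real_smul, mul_comm]

theorem contDiff_fourierInv {N : ℕ} {f : ℝ → ℂ}
    (hf : ∀ n : ℕ, n ≤ N → Integrable (fun w : ℝ => w ^ n • f w)) : ContDiff ℝ N (𝓕⁻ f) := by
  have hE : 𝓕⁻ f = (𝓕 f) ∘ Neg.neg := by
    funext x; exact Real.fourierInv_eq_fourier_neg f x
  rw [hE]
  refine ContDiff.comp ?_ contDiff_neg
  refine Real.contDiff_fourier (N := N) fun n hn => ?_
  simpa [norm_smul] using (hf n (by exact_mod_cast hn)).norm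

theorem norm_iteratedDeriv_fourierInv_le {n : ℕ} {f : ℝ → ℂ}
    (hf : ∀ k : ℕ, k ≤ n → Integrable (fun w : ℝ => w ^ k • f w)) (x : ℝ) :
    ‖iteratedDeriv n (𝓕⁻ f) x‖ ≤ (2 * Real.pi) ^ n * ∫ w, |w| ^ n * ‖f w‖ := by
  have hE : 𝓕⁻ f = fun x => (𝓕 f) (-x) := by
    funext x; exact Real.fourierInv_eq_fourier_neg f x
  rw [hE, iteratedDeriv_comp_neg, norm_smul, Real.iteratedDeriv_fourier (N := n)
    (fun k hk => hf k (by exact_mod_cast hk)) le_rfl, Real.fourier_eq, ← integral_const_mul]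
  simp only [norm_pow, norm_neg, norm_one, one_pow, one_mul]
  refine (norm_integral_le_integral_norm _).trans (le_of_eq ?_)
  congr 1 with w
  rw [Circle.norm_smul, norm_smul]
  simp [mul_pow, abs_of_pos Real.pi_pos]
  ring

/-! ### Tilted factors and their kernels. -/

/-- The factor `exp z / (1 + z)` with `z = (2πiw - s) / a`; it is the Fourier transform of the
one-sided exponential kernel after multiplication by `exp (s x)`. -/
noncomputable def tiltedFactor (a s w : ℝ) : ℂ :=
  Complex.exp ((2 * Real.pi * Complex.I * w - s) / a) /
    (1 + (2 * Real.pi * Complex.I * w - s) / a)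

theorem tiltedFactor_zero (a w : ℝ) : tiltedFactor a 0 w = tpFactor a w := by
  simp [tiltedFactor, tpFactor, mul_div_assoc]

theorem fourier_indicator_exp {S : Set ℝ} (hS : MeasurableSet S) (C : ℂ) (b w : ℝ) :
    𝓕 (S.indicator fun t : ℝ => C * Complex.exp (b * t)) w =
      C * ∫ t in S, Complex.exp ((b - 2 * Real.pi * Complex.I * w) * t) := by
  rw [Real.fourier_eq', ← integral_const_mul, ← integral_indicator hS]
  congr 1 with t
  by_cases ht : t ∈ S
  · simp only [Set.indicator_of_mem ht, smul_eq_mul]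
    rw [mul_left_comm, ← Complex.exp_add]
    simp
    left; ring_nf
  · simp [ht]

/-- The kernel is `|a| exp (-1 - a x)` on the half-line from `-1/a` where it decays. A tilt only
changes the exponent `-a` to `s - a`, so one `k` serves every `s`. -/
theorem exists_kernel_tiltedFactor {a : ℝ} (ha : a ≠ 0) :
    ∃ k : ℝ → ℂ, ∀ s : ℝ, |s| < |a| →
      Integrable (fun x : ℝ => (Real.exp (s * x) : ℂ) * k x) ∧
      ∀ w, 𝓕 (fun x : ℝ => (Real.exp (s * x) : ℂ) * k x) w = tiltedFactor a s w := by
  have hmul : ∀ (S : Set ℝ) (C : ℂ) (s : ℝ), (fun x : ℝ => (Real.exp (s * x) : ℂ) *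
      S.indicator (fun t : ℝ => C * Complex.exp ((-a : ℝ) * t)) x) =
      S.indicator (fun t : ℝ => C * Complex.exp ((s - a : ℝ) * t)) := by
    intro S C s
    funext x
    by_cases hx : x ∈ S
    · simp only [Set.indicator_of_mem hx]
      rw [mul_left_comm, Complex.ofReal_exp, ← Complex.exp_add]
      congr 2; push_cast; ring
    · simp [hx]
  have hint : ∀ (S : Set ℝ) (C : ℂ) (s : ℝ), MeasurableSet S →
      IntegrableOn (fun t : ℝ => Complex.exp ((s - a : ℝ) * t)) S →
      Integrable (fun x : ℝ => (Real.exp (s * x) : ℂ) *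
      S.indicator (fun t : ℝ => C * Complex.exp ((-a : ℝ) * t)) x) := by
    intro S C s hS h
    rw [hmul, integrable_indicator_iff hS]
    exact h.const_mul C
  have ha' : (a : ℂ) ≠ 0 := by exact_mod_cast ha
  -- The boundary term at `-1/a` of the exponential integral; both signs of `a` lead to the same
  -- expression.
  have key : ∀ s w : ℝ, s - a ≠ 0 → a * Complex.exp (-1) *
      (-Complex.exp (((s - a : ℝ) - 2 * Real.pi * Complex.I * w) * (-a⁻¹ : ℝ)) /
        ((s - a : ℝ) - 2 * Real.pi * Complex.I * w)) = tiltedFactor a s w := by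
    intro s w h
    have hne : ((s - a : ℝ) - 2 * Real.pi * Complex.I * w : ℂ) ≠ 0 := by
      intro h0
      apply h
      simpa using congrArg Complex.re h0
    have hne2 : (a + (2 * Real.pi * Complex.I * w - s) : ℂ) ≠ 0 := by
      intro h0
      apply hne
      push_cast
      linear_combination -h0
    rw [tiltedFactor, mul_div_assoc', mul_neg, mul_assoc, ← Complex.exp_add]
    rw [show (-1 + ((s - a : ℝ) - 2 * Real.pi * Complex.I * w) * (-a⁻¹ : ℝ) : ℂ) =
      (2 * Real.pi * Complex.I * w - s) / a by push_cast; field_simp; ring]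
    rw [show (1 + (2 * Real.pi * Complex.I * w - s) / a : ℂ) =
      (a + (2 * Real.pi * Complex.I * w - s)) / a by field_simp]
    rw [show ((s - a : ℝ) - 2 * Real.pi * Complex.I * w : ℂ) =
      -(a + (2 * Real.pi * Complex.I * w - s)) by push_cast; ring]
    rw [neg_div_neg_eq]
    field_simp
  rcases lt_or_gt_of_ne ha with h | h
  · refine ⟨(Set.Iic (-a⁻¹)).indicator (fun t : ℝ => (-a * Complex.exp (-1)) *
      Complex.exp ((-a : ℝ) * t)), fun s hs => ?_⟩
    rw [abs_of_neg h] at hs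
    have hs' : 0 < s - a := by linarith [neg_abs_le s]
    refine ⟨hint _ _ s measurableSet_Iic (integrableOn_exp_mul_complex_Iic (by simpa using hs') _),
      fun w => ?_⟩
    rw [hmul, fourier_indicator_exp measurableSet_Iic, integral_exp_mul_complex_Iic (by simpa using hs'),
      ← key s w hs'.ne']
    ring
  · refine ⟨(Set.Ioi (-a⁻¹)).indicator (fun t : ℝ => (a * Complex.exp (-1)) *
      Complex.exp ((-a : ℝ) * t)), fun s hs => ?_⟩
    rw [abs_of_pos h] at hs
    have hs' : s - a < 0 := by linarith [le_abs_self s]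
    refine ⟨hint _ _ s measurableSet_Ioi (integrableOn_exp_mul_complex_Ioi (by simpa using hs') _),
      fun w => ?_⟩
    rw [hmul, fourier_indicator_exp measurableSet_Ioi, integral_exp_mul_complex_Ioi (by simpa using hs'),
      ← key s w hs'.ne]

/-- Multiplication by an exponential commutes with convolution. -/
theorem exp_mul_convolution (k φ : ℝ → ℂ) (s : ℝ) :
    (fun x : ℝ => (Real.exp (s * x) : ℂ) * (k ⋆[ContinuousLinearMap.mul ℂ ℂ] φ) x) =
      (fun x : ℝ => (Real.exp (s * x) : ℂ) * k x) ⋆[ContinuousLinearMap.mul ℂ ℂ]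
        (fun x : ℝ => (Real.exp (s * x) : ℂ) * φ x) := by
  funext x
  simp only [convolution_def, ContinuousLinearMap.mul_apply']
  rw [← integral_const_mul]
  congr 1 with t
  rw [show s * x = s * t + s * (x - t) by ring, Real.exp_add]
  push_cast
  ring

/-- Convolve the kernels. The induction starts with one factor because the empty product `1` is not
the transform of an integrable function. -/
theorem exists_kernel_prod_tiltedFactor {a : ℕ → ℝ} (ha : ∀ ν, a ν ≠ 0) {a₀ : ℝ}
    (ha₀ : ∀ ν, a₀ ≤ |a ν|) (n : ℕ) :
    ∃ k : ℝ → ℂ, ∀ s : ℝ, |s| < a₀ →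
      Integrable (fun x : ℝ => (Real.exp (s * x) : ℂ) * k x) ∧
      ∀ w, 𝓕 (fun x : ℝ => (Real.exp (s * x) : ℂ) * k x) w =
        ∏ ν ∈ Finset.range (n + 1), tiltedFactor (a ν) s w := by
  induction n with
  | zero =>
    obtain ⟨k, hk⟩ := exists_kernel_tiltedFactor (ha 0)
    exact ⟨k, fun s hs => by simpa using hk s (hs.trans_le (ha₀ 0))⟩
  | succ n ih =>
    obtain ⟨k, hk⟩ := ih
    obtain ⟨φ, hφ⟩ := exists_kernel_tiltedFactor (ha (n + 1))
    refine ⟨k ⋆[ContinuousLinearMap.mul ℂ ℂ] φ, fun s hs => ?_⟩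
    obtain ⟨h1, h2⟩ := hk s hs
    obtain ⟨h3, h4⟩ := hφ s (hs.trans_le (ha₀ _))
    rw [exp_mul_convolution]
    refine ⟨h1.integrable_convolution _ h3, fun w => ?_⟩
    rw [Real.fourier_mul_convolution_eq h1 h3, h2, h4, Finset.prod_range_succ _ (n + 1)]

/-! ### Convergence of the infinite product. -/

/-- The exponential cancels the linear term of the denominator, so summability of `a_ν⁻²` suffices.
-/
theorem norm_exp_div_one_add_sub_one_le {z : ℂ} (hz : ‖z‖ ≤ 1 / 2) :
    ‖Complex.exp z / (1 + z) - 1‖ ≤ 2 * ‖z‖ ^ 2 := by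
  have h1 : 1 / 2 ≤ ‖1 + z‖ := by
    have := norm_sub_le (1 + z) z
    rw [add_sub_cancel_right, norm_one] at this
    linarith
  have h0 : 1 + z ≠ 0 := norm_pos_iff.1 (by linarith)
  rw [div_sub_one h0, norm_div, div_le_iff₀ (by linarith), ← sub_sub]
  have := Complex.norm_exp_sub_one_sub_id_le (x := z) (by linarith)
  nlinarith [sq_nonneg ‖z‖]

theorem multipliable_tiltedFactor {a : ℕ → ℝ} (hsum : Summable fun ν => ((a ν) ^ 2)⁻¹)
    (s w : ℝ) : Multipliable fun ν => tiltedFactor (a ν) s w := by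
  set c : ℂ := 2 * Real.pi * Complex.I * w - s with hc
  have hz : ∀ ν, ‖c / a ν‖ ^ 2 = ‖c‖ ^ 2 * ((a ν) ^ 2)⁻¹ := by
    intro ν
    rw [norm_div, div_pow, Complex.norm_real, Real.norm_eq_abs, sq_abs, div_eq_mul_inv]
  have hs2 : Summable fun ν => ‖c / a ν‖ ^ 2 := by
    simp_rw [hz]; exact hsum.mul_left _
  have hev : ∀ᶠ ν in cofinite, ‖c / a ν‖ ^ 2 < (1 / 2) ^ 2 :=
    hs2.tendsto_cofinite_zero.eventually_lt_const (by norm_num)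
  have : Summable fun ν => ‖tiltedFactor (a ν) s w - 1‖ := by
    refine Summable.of_norm_bounded_eventually (hs2.mul_left 2) ?_
    filter_upwards [hev] with ν hν
    rw [norm_norm]
    exact norm_exp_div_one_add_sub_one_le (lt_of_pow_lt_pow_left₀ 2 (by norm_num) hν).le
  simpa using multipliable_one_add_of_summable this

/-! ### Bounds for a single factor. -/

section Factor

variable {a s : ℝ} (hs : |s| < |a|)
include hs

theorem one_sub_div_pos_of_abs_lt : 0 < 1 - s / a := by
  have h : |s / a| < 1 := by
    rw [abs_div]
    exact (div_lt_one ((abs_nonneg s).trans_lt hs)).2 hs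
  linarith [(abs_lt.1 h).2]

omit hs in
theorem one_sub_div_le_norm (w : ℝ) :
    1 - s / a ≤ ‖(1 + (2 * Real.pi * Complex.I * w - s) / a : ℂ)‖ := by
  refine le_trans (le_of_eq ?_) (Complex.re_le_norm _)
  simp [Complex.div_ofReal_re]
  ring

theorem tiltedFactor_denom_ne_zero (w : ℝ) :
    (1 + (2 * Real.pi * Complex.I * w - s) / a : ℂ) ≠ 0 :=
  norm_pos_iff.1 ((one_sub_div_pos_of_abs_lt hs).trans_le (one_sub_div_le_norm w))

theorem tiltedFactor_ne_zero (w : ℝ) : tiltedFactor a s w ≠ 0 :=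
  div_ne_zero (Complex.exp_ne_zero _) (tiltedFactor_denom_ne_zero hs w)

theorem continuous_tiltedFactor : Continuous (tiltedFactor a s) := by
  unfold tiltedFactor
  exact Continuous.div (by fun_prop) (by fun_prop) (tiltedFactor_denom_ne_zero hs)

omit hs in
theorem norm_tiltedFactor (w : ℝ) : ‖tiltedFactor a s w‖ =
    Real.exp (-s / a) / ‖(1 + (2 * Real.pi * Complex.I * w - s) / a : ℂ)‖ := by
  rw [tiltedFactor, norm_div, Complex.norm_exp]
  simp [Complex.div_ofReal_re]

/-- The numerator has constant modulus, and the denominator has constant real part `1 - s / a > 0`,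
which is its whole modulus at `w = 0`. -/
theorem norm_tiltedFactor_le_zero (w : ℝ) : ‖tiltedFactor a s w‖ ≤ ‖tiltedFactor a s 0‖ := by
  rw [norm_tiltedFactor, norm_tiltedFactor]
  have h0 : ‖(1 + (2 * Real.pi * Complex.I * (0 : ℝ) - s) / a : ℂ)‖ = 1 - s / a := by
    rw [show (1 + (2 * Real.pi * Complex.I * (0 : ℝ) - s) / a : ℂ) = ((1 - s / a : ℝ) : ℂ) by
      push_cast; ring, Complex.norm_real, Real.norm_of_nonneg (one_sub_div_pos_of_abs_lt hs).le]
  have := one_sub_div_le_norm (a := a) (s := s) w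
  have hp := one_sub_div_pos_of_abs_lt hs
  rw [h0]
  gcongr

theorem exists_tiltedFactor_decay :
    ∃ C : ℝ, ∀ w, (1 + |w|) * ‖tiltedFactor a s w‖ ≤ C := by
  have ha : 0 < |a| := (abs_nonneg s).trans_lt hs
  refine ⟨‖tiltedFactor a s 0‖ + Real.exp (-s / a) * |a|, fun w => ?_⟩
  rw [add_mul, one_mul]
  refine add_le_add (norm_tiltedFactor_le_zero hs w) ?_
  rw [norm_tiltedFactor]
  have hpos := norm_pos_iff.2 (tiltedFactor_denom_ne_zero hs w)
  rw [mul_div_assoc', div_le_iff₀ hpos, mul_comm |w|, mul_assoc]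
  refine mul_le_mul_of_nonneg_left ?_ (Real.exp_pos _).le
  -- The imaginary part of the denominator supplies the linear growth.
  have h1 : |2 * Real.pi * w / a| ≤ ‖(1 + (2 * Real.pi * Complex.I * w - s) / a : ℂ)‖ := by
    refine le_trans (le_of_eq ?_) (Complex.abs_im_le_norm _)
    simp [Complex.div_ofReal_im]
  rw [abs_div, div_le_iff₀ ha, abs_mul, abs_of_pos Real.two_pi_pos] at h1
  nlinarith [abs_nonneg w, Real.pi_gt_three]

end Factor

/-! ### Uniform decay of the products. -/

/-- The partial products of the tilted factors. -/
noncomputable def tiltedProd (a : ℕ → ℝ) (s : ℝ) (n : ℕ) (w : ℝ) : ℂ :=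
  ∏ ν ∈ Finset.range n, tiltedFactor (a ν) s w

/-- The infinite product of the tilted factors. -/
noncomputable def tiltedLim (a : ℕ → ℝ) (s w : ℝ) : ℂ := ∏' ν, tiltedFactor (a ν) s w

theorem tendsto_tiltedProd {a : ℕ → ℝ} (hsum : Summable fun ν => ((a ν) ^ 2)⁻¹) (s w : ℝ) :
    Tendsto (fun n => tiltedProd a s n w) atTop (𝓝 (tiltedLim a s w)) :=
  (multipliable_tiltedFactor hsum s w).hasProd.tendsto_prod_nat

section Product

variable {a : ℕ → ℝ} {s : ℝ} (hs : ∀ ν, |s| < |a ν|)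
include hs

theorem continuous_tiltedProd (n : ℕ) : Continuous (tiltedProd a s n) :=
  continuous_finsetProd _ fun ν _ => continuous_tiltedFactor (hs ν)

theorem exists_tiltedProd_decay (M : ℕ) :
    ∃ C : ℝ, ∀ w, (1 + |w|) ^ M * ‖tiltedProd a s M w‖ ≤ C := by
  choose C hC using fun ν => exists_tiltedFactor_decay (hs ν)
  refine ⟨∏ ν ∈ Finset.range M, C ν, fun w => ?_⟩
  have : (1 + |w|) ^ M * ‖tiltedProd a s M w‖ =
      ∏ ν ∈ Finset.range M, ((1 + |w|) * ‖tiltedFactor (a ν) s w‖) := by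
    rw [tiltedProd, norm_prod, Finset.prod_mul_distrib, Finset.prod_const, Finset.card_range]
  rw [this]
  exact Finset.prod_le_prod (fun ν _ => by positivity) fun ν _ => hC ν w

/-- Each factor beyond the first `M` is largest at `0`, so it cannot spoil the decay of those `M`.
-/
theorem norm_tiltedProd_mul_le {M n : ℕ} (hMn : M ≤ n) (w : ℝ) :
    ‖tiltedProd a s n w‖ * ‖tiltedProd a s M 0‖ ≤ ‖tiltedProd a s M w‖ * ‖tiltedProd a s n 0‖ := by
  induction n, hMn using Nat.le_induction with
  | base => exact le_rfl
  | succ n _ ih =>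
    have h := fun w => (Finset.prod_range_succ (fun ν => tiltedFactor (a ν) s w) n)
    rw [tiltedProd, h, ← tiltedProd, norm_mul, tiltedProd.eq_1 a s (n + 1), h, ← tiltedProd,
      norm_mul]
    calc _ = (‖tiltedProd a s n w‖ * ‖tiltedProd a s M 0‖) * ‖tiltedFactor (a n) s w‖ := by ring
      _ ≤ (‖tiltedProd a s M w‖ * ‖tiltedProd a s n 0‖) * ‖tiltedFactor (a n) s 0‖ := by
        gcongr
        exact norm_tiltedFactor_le_zero (hs n) w
      _ = _ := by ring

/-- Decay of arbitrary order of the partial products, uniformly in the number of factors. -/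
theorem exists_tiltedProd_uniform_decay (hsum : Summable fun ν => ((a ν) ^ 2)⁻¹) (M : ℕ) :
    ∃ C : ℝ, ∀ n, M ≤ n → ∀ w, ‖tiltedProd a s n w‖ ≤ C * ((1 + |w|) ^ M)⁻¹ := by
  obtain ⟨C, hC⟩ := exists_tiltedProd_decay hs M
  -- Convergence at the single point `0` bounds the tails uniformly in `n`.
  obtain ⟨B, hB⟩ := (tendsto_tiltedProd hsum s 0).norm.bddAbove_range
  have hB' : ∀ n, ‖tiltedProd a s n 0‖ ≤ B := fun n => hB ⟨n, rfl⟩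
  have hM : 0 < ‖tiltedProd a s M 0‖ :=
    norm_pos_iff.2 (Finset.prod_ne_zero_iff.2 fun ν _ => tiltedFactor_ne_zero (hs ν) 0)
  refine ⟨C * B / ‖tiltedProd a s M 0‖, fun n hn w => ?_⟩
  have h1 := norm_tiltedProd_mul_le hs hn w
  have hw : 0 < (1 + |w|) ^ M := by positivity
  rw [div_mul_eq_mul_div, le_div_iff₀ hM, ← div_eq_mul_inv, le_div_iff₀ hw]
  calc _ ≤ (‖tiltedProd a s M w‖ * ‖tiltedProd a s n 0‖) * (1 + |w|) ^ M := by gcongr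
    _ = ((1 + |w|) ^ M * ‖tiltedProd a s M w‖) * ‖tiltedProd a s n 0‖ := by ring
    _ ≤ C * B := by
      have := hC w
      have h2 := hB' n
      have : 0 ≤ C := le_trans (by positivity) (hC w)
      gcongr

end Product

theorem pow_mul_inv_one_add_abs_pow_le (w : ℝ) {k m : ℕ} (hkm : k + 2 ≤ m) :
    |w| ^ k * ((1 + |w|) ^ m)⁻¹ ≤ (1 + w ^ 2)⁻¹ := by
  have h1 : (1 : ℝ) ≤ 1 + |w| := by linarith [abs_nonneg w]
  have h2 : 0 < 1 + w ^ 2 := by positivity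
  rw [← div_eq_mul_inv, div_le_iff₀ (by positivity), inv_mul_eq_div, le_div_iff₀ h2]
  calc |w| ^ k * (1 + w ^ 2) ≤ (1 + |w|) ^ k * (1 + |w|) ^ 2 := by
        gcongr
        · linarith
        · nlinarith [abs_nonneg w, sq_abs w]
    _ = (1 + |w|) ^ (k + 2) := by ring
    _ ≤ (1 + |w|) ^ m := pow_le_pow_right₀ h1 hkm

theorem integrable_pow_smul_of_decay {f : ℝ → ℂ} (hf : AEStronglyMeasurable f) {C : ℝ} {k m : ℕ}
    (hkm : k + 2 ≤ m) (hC : ∀ w, ‖f w‖ ≤ C * ((1 + |w|) ^ m)⁻¹) :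
    Integrable fun w : ℝ => w ^ k • f w := by
  refine (integrable_inv_one_add_sq.const_mul C).mono'
    ((continuous_pow k).aestronglyMeasurable.smul hf) (ae_of_all _ fun w => ?_)
  have hC0 : 0 ≤ C := by
    have := (norm_nonneg _).trans (hC 0)
    simpa using this
  rw [norm_smul, norm_pow, Real.norm_eq_abs]
  calc |w| ^ k * ‖f w‖ ≤ |w| ^ k * (C * ((1 + |w|) ^ m)⁻¹) := by gcongr; exact hC w
    _ = C * (|w| ^ k * ((1 + |w|) ^ m)⁻¹) := by ring
    _ ≤ _ := by gcongr; exact pow_mul_inv_one_add_abs_pow_le w hkm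

/-! ### Weighted `L¹` convergence of the products. -/

section Limit

variable {a : ℕ → ℝ} {s : ℝ} (hs : ∀ ν, |s| < |a ν|) (hsum : Summable fun ν => ((a ν) ^ 2)⁻¹)
include hs hsum

theorem exists_tiltedLim_decay (M : ℕ) :
    ∃ C : ℝ, (∀ n, M ≤ n → ∀ w, ‖tiltedProd a s n w‖ ≤ C * ((1 + |w|) ^ M)⁻¹) ∧
      ∀ w, ‖tiltedLim a s w‖ ≤ C * ((1 + |w|) ^ M)⁻¹ := by
  obtain ⟨C, hC⟩ := exists_tiltedProd_uniform_decay hs hsum M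
  refine ⟨C, hC, fun w => le_of_tendsto (tendsto_tiltedProd hsum s w).norm ?_⟩
  filter_upwards [eventually_ge_atTop M] with n hn using hC n hn w

theorem aestronglyMeasurable_tiltedLim : AEStronglyMeasurable (tiltedLim a s) :=
  aestronglyMeasurable_of_tendsto_ae atTop
    (fun n => (continuous_tiltedProd hs n).aestronglyMeasurable)
    (ae_of_all _ fun w => tendsto_tiltedProd hsum s w)

theorem integrable_pow_smul_tiltedProd {k n : ℕ} (hn : k + 2 ≤ n) :
    Integrable fun w : ℝ => w ^ k • tiltedProd a s n w := by
  obtain ⟨C, hC⟩ := exists_tiltedProd_uniform_decay hs hsum n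
  exact integrable_pow_smul_of_decay (continuous_tiltedProd hs n).aestronglyMeasurable hn
    (hC n le_rfl)

theorem integrable_pow_smul_tiltedLim (k : ℕ) :
    Integrable fun w : ℝ => w ^ k • tiltedLim a s w := by
  obtain ⟨C, -, hC⟩ := exists_tiltedLim_decay hs hsum (k + 2)
  exact integrable_pow_smul_of_decay (aestronglyMeasurable_tiltedLim hs hsum) le_rfl hC

/-- Dominated convergence: decay of order `k + 2` absorbs `|w| ^ k` and leaves the majorant `2C / (1
+ w²)`. -/
theorem tendsto_integral_tiltedProd_sub (k : ℕ) :
    Tendsto (fun n => ∫ w, |w| ^ k * ‖tiltedLim a s w - tiltedProd a s n w‖) atTop (𝓝 0) := by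
  obtain ⟨C, hC, hC'⟩ := exists_tiltedLim_decay hs hsum (k + 2)
  have hC0 : 0 ≤ C := by simpa using (norm_nonneg _).trans (hC' 0)
  rw [← integral_zero ℝ ℝ]
  refine tendsto_integral_filter_of_dominated_convergence
    (fun w => (2 * C) * (1 + w ^ 2)⁻¹) ?_ ?_ (integrable_inv_one_add_sq.const_mul _) ?_
  · refine Eventually.of_forall fun n => AEStronglyMeasurable.mul (by fun_prop) ?_
    exact ((aestronglyMeasurable_tiltedLim hs hsum).sub
      (continuous_tiltedProd hs n).aestronglyMeasurable).norm
  · filter_upwards [eventually_ge_atTop (k + 2)] with n hn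
    refine ae_of_all _ fun w => ?_
    rw [Real.norm_of_nonneg (by positivity)]
    calc |w| ^ k * ‖tiltedLim a s w - tiltedProd a s n w‖
        ≤ |w| ^ k * (C * ((1 + |w|) ^ (k + 2))⁻¹ + C * ((1 + |w|) ^ (k + 2))⁻¹) := by
          gcongr
          exact (norm_sub_le _ _).trans (add_le_add (hC' w) (hC n hn w))
      _ = (2 * C) * (|w| ^ k * ((1 + |w|) ^ (k + 2))⁻¹) := by ring
      _ ≤ _ := by gcongr; exact pow_mul_inv_one_add_abs_pow_le w le_rfl
  · refine ae_of_all _ fun w => ?_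
    have := ((tendsto_tiltedProd hsum s w).const_sub (tiltedLim a s w)).norm.const_mul (|w| ^ k)
    simpa using this

end Limit

/-! ### Exponential weights as shifts of the transform. -/

theorem fourierInv_sub_of_integrable {f g : ℝ → ℂ} (hf : Integrable f) (hg : Integrable g) :
    𝓕⁻ (fun w => f w - g w) = fun x => 𝓕⁻ f x - 𝓕⁻ g x := by
  funext x
  have h : ∀ {f : ℝ → ℂ}, Integrable f →
      Integrable (fun v : ℝ => Real.fourierChar (inner ℝ v x) • f v) := by
    intro f hf
    have := (Real.fourierIntegral_convergent_iff (-x)).2 hf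
    simpa using this
  simp only [Real.fourierInv_eq, smul_sub]
  exact integral_sub (h hf) (h hg)

theorem iteratedDeriv_cexp_ofReal_mul (c : ℂ) (n : ℕ) :
    iteratedDeriv n (fun x : ℝ => Complex.exp (c * x)) =
      fun x : ℝ => c ^ n * Complex.exp (c * x) := by
  induction n with
  | zero => simp
  | succ n ih =>
    rw [iteratedDeriv_succ, ih]
    funext x
    have h1 : HasDerivAt (fun x : ℝ => c * (x : ℂ)) (c * 1) x :=
      (Complex.ofRealCLM.hasDerivAt (x := x)).const_mul c
    rw [(h1.cexp.const_mul (c ^ n)).deriv]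
    ring

section Tilt

variable {a : ℕ → ℝ} (ha : ∀ ν, a ν ≠ 0) (hsum : Summable fun ν => ((a ν) ^ 2)⁻¹)
  {a₀ : ℝ} (ha₀ : ∀ ν, a₀ ≤ |a ν|)

theorem integrable_tiltedProd {s : ℝ} (hs : ∀ ν, |s| < |a ν|)
    (hsum : Summable fun ν => ((a ν) ^ 2)⁻¹) {n : ℕ} (hn : 2 ≤ n) :
    Integrable (tiltedProd a s n) := by
  simpa using integrable_pow_smul_tiltedProd hs hsum (k := 0) (by simpa using hn)

theorem integrable_tiltedLim {s : ℝ} (hs : ∀ ν, |s| < |a ν|)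
    (hsum : Summable fun ν => ((a ν) ^ 2)⁻¹) : Integrable (tiltedLim a s) := by
  simpa using integrable_pow_smul_tiltedLim hs hsum 0

include ha hsum ha₀ in
/-- Multiplication by an exponential amounts to a shift of the Fourier transform into the
complex plane. -/
theorem fourierInv_tiltedProd_eq {s : ℝ} (hs : |s| < a₀) {n : ℕ} (hn : 2 ≤ n) (x : ℝ) :
    𝓕⁻ (tiltedProd a s n) x = Complex.exp (s * x) * 𝓕⁻ (tiltedProd a 0 n) x := by
  obtain ⟨k, hk⟩ := exists_kernel_prod_tiltedFactor ha ha₀ (n - 1)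
  rw [Nat.sub_add_cancel (by lia)] at hk
  -- The same `k` underlies the tilts `s` and `0`; comparing them gives the identity almost
  -- everywhere, and continuity gives it everywhere.
  have key : ∀ s, |s| < a₀ → (fun x : ℝ => (Real.exp (s * x) : ℂ) * k x) =ᵐ[volume]
      𝓕⁻ (tiltedProd a s n) := by
    intro s hs
    obtain ⟨h1, h2⟩ := hk s hs
    have h3 : 𝓕 (fun x : ℝ => (Real.exp (s * x) : ℂ) * k x) = tiltedProd a s n := funext h2
    have := h1.ae_eq_fourierInv_fourier
      (h3 ▸ integrable_tiltedProd (fun ν => hs.trans_le (ha₀ ν)) hsum hn)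
    rwa [h3] at this
  have h0 : |(0 : ℝ)| < a₀ := by simpa using (abs_nonneg s).trans_lt hs
  have hcont : ∀ s, |s| < a₀ → Continuous (𝓕⁻ (tiltedProd a s n)) := fun s hs =>
    continuous_fourierInv_of_integrable
      (integrable_tiltedProd (fun ν => hs.trans_le (ha₀ ν)) hsum hn)
  have hc0 := hcont 0 h0
  refine congrFun (((hcont s hs).ae_eq_iff_eq volume
    (g := fun x : ℝ => Complex.exp (s * x) * 𝓕⁻ (tiltedProd a 0 n) x) (by fun_prop)).1 ?_) x
  filter_upwards [key s hs, key 0 h0] with y h1 h2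
  rw [← h1, ← h2]
  simp

theorem norm_iteratedDeriv_fourierInv_sub_le {s : ℝ} (hs : ∀ ν, |s| < |a ν|)
    (hsum : Summable fun ν => ((a ν) ^ 2)⁻¹) {k n : ℕ} (hn : k + 2 ≤ n) (x : ℝ) :
    ‖iteratedDeriv k (fun x => 𝓕⁻ (tiltedLim a s) x - 𝓕⁻ (tiltedProd a s n) x) x‖ ≤
      (2 * Real.pi) ^ k * ∫ w, |w| ^ k * ‖tiltedLim a s w - tiltedProd a s n w‖ := by
  rw [← fourierInv_sub_of_integrable (integrable_tiltedLim hs hsum)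
    (integrable_tiltedProd hs hsum (by lia))]
  refine norm_iteratedDeriv_fourierInv_le (fun j hj => ?_) x
  simp only [smul_sub]
  exact (integrable_pow_smul_tiltedLim hs hsum j).sub
    (integrable_pow_smul_tiltedProd hs hsum (by lia))

theorem contDiff_fourierInv_tiltedProd {s : ℝ} (hs : ∀ ν, |s| < |a ν|)
    (hsum : Summable fun ν => ((a ν) ^ 2)⁻¹) {r n : ℕ} (hn : r + 2 ≤ n) :
    ContDiff ℝ r (𝓕⁻ (tiltedProd a s n)) :=
  contDiff_fourierInv fun _ hk => integrable_pow_smul_tiltedProd hs hsum (by lia)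

theorem contDiff_fourierInv_tiltedLim {s : ℝ} (hs : ∀ ν, |s| < |a ν|)
    (hsum : Summable fun ν => ((a ν) ^ 2)⁻¹) (r : ℕ) :
    ContDiff ℝ r (𝓕⁻ (tiltedLim a s)) :=
  contDiff_fourierInv fun k _ => integrable_pow_smul_tiltedLim hs hsum k

include ha hsum ha₀ in
-- Both sides are limits of the finite products' identity at fixed `x`, so no kernel for the
-- infinite product is needed.
theorem fourierInv_tiltedLim_eq {s : ℝ} (hs : |s| < a₀) (x : ℝ) :
    𝓕⁻ (tiltedLim a s) x = Complex.exp (s * x) * 𝓕⁻ (tiltedLim a 0) x := by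
  have key : ∀ s, |s| < a₀ → Tendsto (fun n => 𝓕⁻ (tiltedProd a s n) x) atTop
      (𝓝 (𝓕⁻ (tiltedLim a s) x)) := by
    intro s hs
    have hs' : ∀ ν, |s| < |a ν| := fun ν => hs.trans_le (ha₀ ν)
    rw [tendsto_iff_norm_sub_tendsto_zero]
    refine squeeze_zero' (Eventually.of_forall fun _ => norm_nonneg _) ?_
      (tendsto_integral_tiltedProd_sub hs' hsum 0)
    filter_upwards [eventually_ge_atTop 2] with n hn
    have := norm_iteratedDeriv_fourierInv_sub_le hs' hsum (k := 0) (by simpa using hn) x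
    rw [iteratedDeriv_zero, pow_zero, one_mul] at this
    rwa [norm_sub_rev]
  have h0 : |(0 : ℝ)| < a₀ := by simpa using (abs_nonneg s).trans_lt hs
  refine tendsto_nhds_unique (key s hs) (((key 0 h0).const_mul _).congr' ?_)
  filter_upwards [eventually_ge_atTop 2] with n hn
  exact (fourierInv_tiltedProd_eq ha hsum ha₀ hs hn x).symm

include ha hsum ha₀ in
/-- Uniform convergence of all derivatives with an exponential weight. -/
theorem exists_tendsto_zero_exp_mul_norm_iteratedDeriv_le {s : ℝ} (hs : |s| < a₀) (r : ℕ) :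
    ∃ δ : ℕ → ℝ, Tendsto δ atTop (𝓝 0) ∧ ∀ n, r + 2 ≤ n → ∀ x,
      Real.exp (s * x) * ‖iteratedDeriv r
        (fun x => 𝓕⁻ (tiltedLim a 0) x - 𝓕⁻ (tiltedProd a 0 n) x) x‖ ≤ δ n := by
  have hs' : ∀ ν, |s| < |a ν| := fun ν => hs.trans_le (ha₀ ν)
  -- Leibniz bound for `exp (-s x) * E x`, with `E` the tilted difference: differentiating the
  -- exponential `i` times yields `|s| ^ i`, and the weight `exp (s x)` cancels what remains of it.
  refine ⟨fun n => ∑ i ∈ Finset.range (r + 1), (r.choose i * |s| ^ i) *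
    ((2 * Real.pi) ^ (r - i) *
      ∫ w, |w| ^ (r - i) * ‖tiltedLim a s w - tiltedProd a s n w‖), ?_, fun n hn x => ?_⟩
  · have : Tendsto (fun n => ∑ i ∈ Finset.range (r + 1), (r.choose i * |s| ^ i) *
        ((2 * Real.pi) ^ (r - i) *
        ∫ w, |w| ^ (r - i) * ‖tiltedLim a s w - tiltedProd a s n w‖)) atTop
        (𝓝 (∑ i ∈ Finset.range (r + 1), (r.choose i * |s| ^ i) * ((2 * Real.pi) ^ (r - i) * 0))) :=
      tendsto_finsetSum _ fun i _ =>
        ((tendsto_integral_tiltedProd_sub hs' hsum (r - i)).const_mul _).const_mul _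
    simpa using this
  · set E : ℝ → ℂ := fun x => 𝓕⁻ (tiltedLim a s) x - 𝓕⁻ (tiltedProd a s n) x with hE
    have hEc : ContDiff ℝ r E :=
      (contDiff_fourierInv_tiltedLim hs' hsum r).sub (contDiff_fourierInv_tiltedProd hs' hsum hn)
    have hD : (fun x => 𝓕⁻ (tiltedLim a 0) x - 𝓕⁻ (tiltedProd a 0 n) x) =
        fun x : ℝ => Complex.exp ((-s : ℂ) * x) * E x := by
      funext y
      simp only [hE]
      rw [fourierInv_tiltedLim_eq ha hsum ha₀ hs,
        fourierInv_tiltedProd_eq ha hsum ha₀ hs (n := n) (by lia), ← mul_sub, ← mul_assoc,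
        ← Complex.exp_add]
      simp
    have hexp : ContDiff ℝ r (fun x : ℝ => Complex.exp ((-s : ℂ) * x)) :=
      (contDiff_const.mul Complex.ofRealCLM.contDiff).cexp
    rw [hD, iteratedDeriv_fun_mul hexp.contDiffAt hEc.contDiffAt]
    refine (mul_le_mul_of_nonneg_left (norm_sum_le _ _) (Real.exp_pos _).le).trans ?_
    rw [Finset.mul_sum]
    refine Finset.sum_le_sum fun i hi => ?_
    rw [iteratedDeriv_cexp_ofReal_mul, norm_mul, norm_mul, norm_mul, norm_pow, norm_neg,
      Complex.norm_real, Real.norm_eq_abs, Complex.norm_natCast, Complex.norm_exp]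
    have hre : ((-s : ℂ) * x).re = -(s * x) := by simp
    rw [hre]
    have hb := norm_iteratedDeriv_fourierInv_sub_le hs' hsum (k := r - i) (n := n) (by lia) x
    have hone : Real.exp (s * x) * Real.exp (-(s * x)) = 1 := by
      rw [← Real.exp_add, add_neg_cancel, Real.exp_zero]
    calc _ = (Real.exp (s * x) * Real.exp (-(s * x))) * ((r.choose i * |s| ^ i) *
          ‖iteratedDeriv (r - i) E x‖) := by ring
      _ ≤ _ := by
        rw [hone, one_mul]
        gcongr

end Tilt

/-! ### Identification of the functions and conclusion. -/

theorem abs_iteratedDeriv_eq_norm {u : ℝ → ℝ} {r : ℕ} (hu : ContDiff ℝ r u) (x : ℝ) :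
    |iteratedDeriv r u x| = ‖iteratedDeriv r (fun x => (u x : ℂ)) x‖ := by
  rw [← Real.norm_eq_abs, ← norm_iteratedFDeriv_eq_norm_iteratedDeriv,
    ← norm_iteratedFDeriv_eq_norm_iteratedDeriv]
  exact (Complex.ofRealLI.norm_iteratedFDeriv_comp_left hu.contDiffAt le_rfl).symm

/-- An integrable function with integrable Fourier transform which is totally positive or
continuous is given by the inversion formula everywhere. -/
theorem eq_fourierInv_of_isTotallyPositive_or_continuous {f : ℝ → ℝ} (hf : Integrable f)
    {P : ℝ → ℂ} (hP : Integrable P) (hfP : 𝓕 (fun t : ℝ => (f t : ℂ)) = P) (hP0 : P 0 ≠ 0)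
    (hrep : IsTotallyPositive f ∨ Continuous f) (x : ℝ) : (f x : ℂ) = 𝓕⁻ P x := by
  have hae : (fun t : ℝ => (f t : ℂ)) =ᵐ[volume] 𝓕⁻ P := by
    have hfC : Integrable fun t : ℝ => (f t : ℂ) := hf.ofReal
    have := hfC.ae_eq_fourierInv_fourier (hfP.symm ▸ hP)
    rwa [hfP] at this
  have hc := continuous_fourierInv_of_integrable hP
  have hfc : Continuous f := by
    refine hrep.elim (fun h => ?_) id
    have hG : Continuous fun x => (𝓕⁻ P x).re := Complex.continuous_re.comp hc
    have hae' : f =ᵐ[volume] fun x => (𝓕⁻ P x).re := by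
      filter_upwards [hae] with t ht
      rw [← ht, Complex.ofReal_re]
    rw [h.eq_of_ae_eq_continuous hG hae' ?_]
    · exact hG
    -- A vanishing continuous representative would make `P 0 = ∫ f` zero.
    · by_contra! h0
      apply hP0
      rw [← hfP, Real.fourier_eq]
      refine integral_eq_zero_of_ae ?_
      filter_upwards [hae'] with t ht
      simp [ht, h0 t]
  exact congrFun (((Complex.continuous_ofReal.comp hfc).ae_eq_iff_eq volume hc).1 hae) x

theorem tpFactor_zero (a : ℝ) : tpFactor a 0 = 1 := by simp [tpFactor]

section Representation

variable {a : ℕ → ℝ} (ha : ∀ ν, a ν ≠ 0) (hsum : Summable fun ν => ((a ν) ^ 2)⁻¹)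
include ha hsum

/-- Two factors are needed: a single one decays only like `1 / |w|` and is not integrable. -/
theorem IsTPOfFiniteType.eq_fourierInv {n : ℕ} (hn : 2 ≤ n) {f : ℝ → ℝ}
    (hf : IsTPOfFiniteType a n f) (x : ℝ) : (f x : ℂ) = 𝓕⁻ (tiltedProd a 0 n) x := by
  have h0 : ∀ ν, |(0 : ℝ)| < |a ν| := fun ν => by simpa using ha ν
  refine eq_fourierInv_of_isTotallyPositive_or_continuous hf.integrable
    (integrable_tiltedProd h0 hsum hn) ?_ ?_ hf.representative x
  · funext w
    simp only [hf.fourier, tiltedProd, tiltedFactor_zero]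
  · simp [tiltedProd, tiltedFactor_zero, tpFactor_zero]

theorem IsTPOfInfiniteType.eq_fourierInv {f : ℝ → ℝ}
    (hf : IsTPOfInfiniteType a f) (x : ℝ) : (f x : ℂ) = 𝓕⁻ (tiltedLim a 0) x := by
  have h0 : ∀ ν, |(0 : ℝ)| < |a ν| := fun ν => by simpa using ha ν
  refine eq_fourierInv_of_isTotallyPositive_or_continuous hf.integrable
    (integrable_tiltedLim h0 hsum) ?_ ?_ hf.representative x
  · funext w
    simp only [tiltedLim, tiltedFactor_zero, (hf.fourier w).tprod_eq]
  · simp [tiltedLim, tiltedFactor_zero, tpFactor_zero]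

end Representation

theorem contDiff_of_ofReal_eq {f : ℝ → ℝ} {F : ℝ → ℂ} (h : ∀ x, (f x : ℂ) = F x)
    {r : WithTop ℕ∞} (hF : ContDiff ℝ r F) : ContDiff ℝ r f := by
  have : f = fun x => Complex.reCLM (F x) := by
    funext x; simp [← h x]
  rw [this]
  exact Complex.reCLM.contDiff.comp hF

theorem exp_mul_abs_le (σ x : ℝ) :
    Real.exp (σ * |x|) ≤ Real.exp (σ * x) + Real.exp (-σ * x) := by
  rcases abs_cases x with ⟨h, -⟩ | ⟨h, -⟩ <;> rw [h]
  · linarith [Real.exp_pos (-σ * x)]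
  · rw [mul_neg, ← neg_mul]; linarith [Real.exp_pos (σ * x)]

theorem mainTheorem4 (a : ℕ → ℝ) (ha : ∀ ν, a ν ≠ 0) (hsum : Summable fun ν => ((a ν) ^ 2)⁻¹)
    (a₀ : ℝ) (ha₀ : IsLeast (Set.range fun ν => |a ν|) a₀)
    (g : ℝ → ℝ) (hg : IsTPOfInfiniteType a g)
    (gn : ℕ → ℝ → ℝ) (hgn : ∀ n, 1 ≤ n → IsTPOfFiniteType a n (gn n)) :
    (∀ σ : ℝ, 0 ≤ σ → σ < a₀ →
      TendstoUniformly (fun (n : ℕ) (x : ℝ) => |g x - gn n x| * Real.exp (σ * |x|))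
        (fun _ => 0) Filter.atTop) ∧
    ContDiff ℝ ∞ g ∧
    ∀ r : ℕ,
      (∀ᶠ n in Filter.atTop, ContDiff ℝ r (gn n)) ∧
      ∀ σ : ℝ, 0 ≤ σ → σ < a₀ →
        TendstoUniformly
          (fun (n : ℕ) (x : ℝ) =>
            |iteratedDeriv r g x - iteratedDeriv r (gn n) x| * Real.exp (σ * |x|))
          (fun _ => 0) Filter.atTop := by
  have hle : ∀ ν, a₀ ≤ |a ν| := fun ν => ha₀.2 ⟨ν, rfl⟩
  have h0 : ∀ ν, |(0 : ℝ)| < |a ν| := fun ν => by simpa using ha ν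
  have hgE := hg.eq_fourierInv ha hsum
  have hgnE : ∀ n, 2 ≤ n → ∀ x, (gn n x : ℂ) = 𝓕⁻ (tiltedProd a 0 n) x := fun n hn =>
    (hgn n (by lia)).eq_fourierInv ha hsum hn
  have hgc : ∀ r : ℕ, ContDiff ℝ r g := fun r =>
    contDiff_of_ofReal_eq hgE (contDiff_fourierInv_tiltedLim h0 hsum r)
  have hgnc : ∀ r n : ℕ, r + 2 ≤ n → ContDiff ℝ r (gn n) := fun r n hn =>
    contDiff_of_ofReal_eq (hgnE n (by lia)) (contDiff_fourierInv_tiltedProd h0 hsum hn)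
  have main : ∀ r : ℕ, ∀ σ : ℝ, 0 ≤ σ → σ < a₀ →
      TendstoUniformly
        (fun (n : ℕ) (x : ℝ) =>
          |iteratedDeriv r g x - iteratedDeriv r (gn n) x| * Real.exp (σ * |x|))
        (fun _ => 0) Filter.atTop := by
    intro r σ hσ hσa
    -- The tilts `σ` and `-σ` control the right and left tails; the sum of their bounds dominates
    -- the two-sided weight.
    obtain ⟨δ, hδ, hδb⟩ := exists_tendsto_zero_exp_mul_norm_iteratedDeriv_le ha hsum hle
      (s := σ) (by rwa [abs_of_nonneg hσ]) r
    obtain ⟨δ', hδ', hδb'⟩ := exists_tendsto_zero_exp_mul_norm_iteratedDeriv_le ha hsum hle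
      (s := -σ) (by rwa [abs_neg, abs_of_nonneg hσ]) r
    rw [Metric.tendstoUniformly_iff]
    intro ε hε
    have hsumδ := hδ.add hδ'
    rw [add_zero] at hsumδ
    filter_upwards [hsumδ.eventually_lt_const hε, eventually_ge_atTop (r + 2)] with n hn1 hn2 x
    rw [dist_zero_left, Real.norm_of_nonneg (by positivity)]
    refine lt_of_le_of_lt ?_ hn1
    have hcd : ContDiff ℝ r (fun x => g x - gn n x) := (hgc r).sub (hgnc r n hn2)
    have hfun : (fun x => ((g x - gn n x : ℝ) : ℂ)) =
        fun x => 𝓕⁻ (tiltedLim a 0) x - 𝓕⁻ (tiltedProd a 0 n) x := by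
      funext y
      rw [Complex.ofReal_sub, hgE, hgnE n (by lia)]
    rw [← iteratedDeriv_fun_sub (hgc r).contDiffAt (hgnc r n hn2).contDiffAt,
      abs_iteratedDeriv_eq_norm hcd, hfun]
    calc _ ≤ _ * (Real.exp (σ * x) + Real.exp (-σ * x)) :=
          mul_le_mul_of_nonneg_left (exp_mul_abs_le σ x) (norm_nonneg _)
      _ ≤ _ := by
          rw [mul_comm, add_mul]
          exact add_le_add (hδb n hn2 x) (hδb' n hn2 x)
  refine ⟨fun σ hσ hσa => by simpa using main 0 σ hσ hσa, contDiff_infty.2 hgc, fun r => ⟨?_, main r⟩⟩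
  filter_upwards [eventually_ge_atTop (r + 2)] with n hn using hgnc r n hn
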